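/- A set of non-negative integers is called 3-free if no three distinct elements of it form an arithmetic progression. For a non-empty finite 3-free set $A$ of non-negative integers with elements $a_0<a_1<\cdots<a_r$, the Stanley sequence $S(A)=(a_n)_{n\ge 0}$ is defined greedily: for each $n\ge r$, $a_{n+1}$ is the smallest integer greater than $a_n$ such that $\{a_0,\ldots,a_{n+1}\}$ is 3-free. The sequence $S(A)$ is called independent if there is a constant $\lambda$ such that, for all sufficiently large integers $j$, the equations $$a_{2^j+i}=a_{2^j}+a_i,\qquad a_{2^j}=2a_{2^j-1}-\lambda+1$$ hold for all $0\le i<2^j$. Theorem. Let $k$ be a positive integer, and let $T_1,T_2$ be disjoint subsets of $\{0,1,\ldots,k\}$ such that no $t\in T_1$ satisfies $t-1\in T_2$. Let $$A=\Big\{\sum_{a\in U}3^{a}+2\sum_{b\in V}3^{b}\ \Big|\ U\subseteq T_1,\ V\subseteq T_2\Big\}.$$ Then $A$ is 3-free and $S(A)$ is an independent Stanley sequence. -/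

import Mathlib

/-- The greedy sequence generated by a finite set `A` of non-negative integers: it starts with the
elements of `A` in increasing order, and each later term is the least integer that exceeds all
previous terms and keeps the set of terms free of three-term arithmetic progressions. For `A`
nonempty and 3-free the set under `sInf` is never empty (twice the last term plus one lies in
it). -/
noncomputable def stanleySeq (A : Finset ℕ) (n : ℕ) : ℕ :=
  if h : n < A.card then A.orderEmbOfFin rfl ⟨n, h⟩
  else sInf {x : ℕ | (∀ m : Fin n, stanleySeq A m < x) ∧
    ThreeAPFree (insert x (Set.range fun m : Fin n => stanleySeq A m))}
termination_by n
decreasing_by all_goals exact m.isLt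

/-- `S(A)` is an independent Stanley sequence: `A` is nonempty and 3-free (so that `S(A)` is
defined), and, for some constant `c` (the character) and all sufficiently large `k`,
`a (2 ^ k + i) = a (2 ^ k) + a i` for `0 ≤ i < 2 ^ k` and `a (2 ^ k) = 2 a (2 ^ k - 1) - c + 1`. -/
def IsIndependentStanley (A : Finset ℕ) : Prop :=
  A.Nonempty ∧ ThreeAPFree (A : Set ℕ) ∧
    ∃ c : ℤ, ∃ k₀ : ℕ, ∀ k ≥ k₀,
      (∀ i < 2 ^ k, stanleySeq A (2 ^ k + i) = stanleySeq A (2 ^ k) + stanleySeq A i) ∧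
      (stanleySeq A (2 ^ k) : ℤ) = 2 * (stanleySeq A (2 ^ k - 1) : ℤ) - c + 1

/-- The integers `∑_{a ∈ U} 3 ^ a + 2 ∑_{b ∈ V} 3 ^ b` with `U ⊆ T₁` and `V ⊆ T₂`. -/
def ternaryDigitSet (T₁ T₂ : Finset ℕ) : Finset ℕ :=
  (T₁.powerset ×ˢ T₂.powerset).image
    fun p => ∑ a ∈ p.1, 3 ^ a + 2 * ∑ b ∈ p.2, 3 ^ b

/-!
Let `N` be the largest element of `A`, so that `A` consists of the numbers obtained from `N` by
replacing ternary digits with `0`. The terms of `S(A)` can be described explicitly: from the lowest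
digit upwards, `n` copies or erases the digits of `N`, until possibly a digit `0` of `N` is raised
to `1`; above that place `n` is the sum of `N` and a number with digits `0` and `1`. That this set
is 3-free is seen digit by digit.

To see that it is the greedy extension of `A`, every `z ≥ N` must be the last term of a progression
`x, y, z` of terms. Solving `x + z = 2 * y` from the lowest digit amounts to a subtraction with
borrow. A borrow arises only at a digit `2` of `N`, and every digit of `N` other than `1` can absorb
it or pass it on, so the only obstruction is a digit `1` directly above a digit `2`, which the
hypothesis on `T₁` and `T₂` rules out.

For `2 * N < 3 ^ k` and `m < 3 ^ k`, the number `3 ^ k + m` is a term if and only if `m` is, and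
there are `2 ^ k` terms below `3 ^ k`. Hence `a (2 ^ k + i) = 3 ^ k + a i` for `i < 2 ^ k`, from
which independence follows.
-/

theorem exists_eq_three_mul_add_lt (n : ℕ) : ∃ m d, d < 3 ∧ n = 3 * m + d :=
  ⟨n / 3, n % 3, by omega, by omega⟩

theorem exists_eq_three_mul_or_eq_three_mul_add (N : ℕ) :
    ∃ M, N = 3 * M ∨ ∃ d, (d = 1 ∨ d = 2) ∧ N = 3 * M + d := by
  rcases Nat.eq_zero_or_pos (N % 3) with h | h
  · exact ⟨N / 3, .inl (by omega)⟩
  · exact ⟨N / 3, .inr ⟨N % 3, by omega, by omega⟩⟩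

@[elab_as_elim]
theorem ternary_induction {P : ℕ → Prop} (zero : P 0) (three_mul : ∀ N, P N → P (3 * N))
    (three_mul_add : ∀ N d, d = 1 ∨ d = 2 → P N → P (3 * N + d)) (N : ℕ) : P N := by
  induction N using Nat.strong_induction_on with
  | _ N ih =>
    rcases Nat.eq_zero_or_pos N with rfl | hN
    · exact zero
    obtain ⟨M, rfl | ⟨d, hd, rfl⟩⟩ := exists_eq_three_mul_or_eq_three_mul_add N
    · exact three_mul M (ih M (by omega))
    · exact three_mul_add M d hd (ih M (by omega))

theorem sum_range_succ_mul_three_pow (c : ℕ → ℕ) (m : ℕ) :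
    ∑ i ∈ Finset.range (m + 1), c i * 3 ^ i =
      3 * ∑ i ∈ Finset.range m, c (i + 1) * 3 ^ i + c 0 := by
  rw [Finset.sum_range_succ', Finset.mul_sum, pow_zero, mul_one]
  congr 1
  exact Finset.sum_congr rfl fun i _ => by ring

theorem count_congr_of_lt {p q : ℕ → Prop} [DecidablePred p] [DecidablePred q] {n : ℕ}
    (h : ∀ m < n, p m ↔ q m) :
    Nat.count p n = Nat.count q n :=
  le_antisymm (Nat.count_mono_left fun m hm => (h m hm).1)
    (Nat.count_mono_left fun m hm => (h m hm).2)

theorem count_three_mul (p : ℕ → Prop) [DecidablePred p] (n : ℕ) :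
    Nat.count p (3 * n) = Nat.count (fun m => p (3 * m + 0)) n +
      Nat.count (fun m => p (3 * m + 1)) n + Nat.count (fun m => p (3 * m + 2)) n := by
  induction n with
  | zero => simp only [mul_zero, Nat.count_zero]
  | succ n ih =>
    rw [show 3 * (n + 1) = 3 * n + 0 + 1 + 1 + 1 by ring]
    simp only [Nat.count_succ, ih, add_zero]
    ring

theorem count_three_mul_of_digit_iff {p q : ℕ → Prop} [DecidablePred p] [DecidablePred q]
    {d : ℕ} (hd : d = 1 ∨ d = 2)
    (h : ∀ n, ∀ e < 3, p (3 * n + e) ↔ (e = 0 ∨ e = d) ∧ q n) (n : ℕ) :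
    Nat.count p (3 * n) = 2 * Nat.count q n := by
  rw [count_three_mul]
  rcases hd with rfl | rfl <;>
    simp only [h, Nat.reduceLT, OfNat.ofNat_ne_zero, OfNat.ofNat_ne_one, OfNat.one_ne_ofNat,
      one_ne_zero, true_or, or_true, or_self, true_and, false_and, Nat.count_false] <;>
    ring

theorem count_exists_eq_add (p : ℕ → Prop) [DecidablePred p] (a n : ℕ)
    [DecidablePred fun m => ∃ b, p b ∧ m = a + b] :
    Nat.count (fun m => ∃ b, p b ∧ m = a + b) (a + n) = Nat.count p n := by
  have hlow : Nat.count (fun m => ∃ b, p b ∧ m = a + b) a = 0 :=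
    Nat.count_iff_forall_not.2 <| by rintro _ hm ⟨b, -, rfl⟩; omega
  rw [Nat.count_add, hlow, zero_add]
  exact count_congr_of_lt fun m _ => by simp only [add_right_inj, exists_eq_right']

theorem count_eq_of_forall_not {p : ℕ → Prop} [DecidablePred p] {m n : ℕ} (hmn : m ≤ n)
    (h : ∀ i, m ≤ i → i < n → ¬ p i) : Nat.count p n = Nat.count p m := by
  obtain ⟨l, rfl⟩ := Nat.exists_eq_add_of_le hmn
  have hgap : Nat.count (fun i => p (m + i)) l = 0 :=
    Nat.count_iff_forall_not.2 fun i hi => h _ (by omega) (by omega)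
  rw [Nat.count_add, hgap, add_zero]

theorem nth_count_add {p : ℕ → Prop} [DecidablePred p] (hinf : {n | p n}.Infinite) {M i : ℕ}
    (hperiodic : ∀ m < M, p (M + m) ↔ p m) (hi : i < Nat.count p M) :
    Nat.nth p (Nat.count p M + i) = M + Nat.nth p i := by
  have hlt : Nat.nth p i < M := Nat.nth_lt_of_lt_count hi
  have hcount : Nat.count p (M + Nat.nth p i) = Nat.count p M + i := by
    rw [Nat.count_add, count_congr_of_lt fun m hm => hperiodic m (hm.trans hlt),
      Nat.count_nth_of_infinite hinf]
  rw [← hcount, Nat.nth_count ((hperiodic _ hlt).2 (Nat.nth_mem_of_infinite hinf i))]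

/-- Every `z ≥ d` is the last term of an arithmetic progression `x, y, z` with `p x` and `p y`. The
constant progression is allowed, so numbers satisfying `p` are covered by themselves. If `p` defines
a 3-free set, this says that the set is built greedily above `d`. -/
def CoversAbove (p : ℕ → Prop) (d : ℕ) : Prop :=
  ∀ z ≥ d, ∃ x y, p x ∧ p y ∧ x ≤ y ∧ x + z = 2 * y

theorem card_eq_count_succ {A : Finset ℕ} {p : ℕ → Prop} [DecidablePred p] {d : ℕ}
    (hA : ∀ n, n ∈ A ↔ p n ∧ n ≤ d) : A.card = Nat.count p (d + 1) := by
  rw [Nat.count_eq_card_filter_range]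
  congr 1
  ext n
  rw [hA, Finset.mem_filter, Finset.mem_range, Nat.lt_succ_iff, and_comm]

theorem orderEmbOfFin_eq_nth {A : Finset ℕ} {p : ℕ → Prop} {d : ℕ} (hinf : {n | p n}.Infinite)
    (hA : ∀ n, n ∈ A ↔ p n ∧ n ≤ d) (i : Fin A.card) :
    A.orderEmbOfFin rfl i = Nat.nth p i := by
  classical
  have hmem : ∀ j : Fin A.card, Nat.nth p j ∈ A := fun j =>
    (hA _).2 ⟨Nat.nth_mem_of_infinite hinf _,
      Nat.lt_succ_iff.1 (Nat.nth_lt_of_lt_count (card_eq_count_succ hA ▸ j.2))⟩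
  exact (congrFun (Finset.orderEmbOfFin_unique rfl hmem
    fun _ _ hij => Nat.nth_strictMono hinf hij) i).symm

theorem isLeast_nth_of_coversAbove {p : ℕ → Prop} [DecidablePred p] {d n : ℕ}
    (hinf : {n | p n}.Infinite)
    (hfree : ThreeAPFree {n | p n}) (hcover : CoversAbove p d) (hd : p d)
    (hn : Nat.count p d < n) :
    IsLeast {x | (∀ m : Fin n, Nat.nth p m < x) ∧
      ThreeAPFree (insert x (Set.range fun m : Fin n => Nat.nth p m))} (Nat.nth p n) := by
  refine ⟨⟨fun m => Nat.nth_strictMono hinf m.2, hfree.mono ?_⟩, ?_⟩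
  · rintro x (rfl | ⟨m, rfl⟩) <;> exact Nat.nth_mem_of_infinite hinf _
  rintro z ⟨hgt, hz⟩
  by_contra! hlt
  have hrange : ∀ y, p y → y < Nat.nth p n → y ∈ Set.range fun m : Fin n => Nat.nth p m :=
    fun y hy hyn => ⟨⟨Nat.count p y, by
      simpa only [Nat.count_nth_of_infinite hinf] using Nat.count_strict_mono hy hyn⟩,
      Nat.nth_count hy⟩
  have hdz : d < z := by simpa only [Nat.nth_count hd] using hgt ⟨_, hn⟩
  obtain ⟨x, y, hx, hy, hxy, h⟩ := hcover z hdz.le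
  obtain ⟨m, hm⟩ := hrange y hy (by omega)
  have hyz : y < z := hm ▸ hgt m
  have := hz (.inr (hrange x hx (by omega))) (.inr ⟨m, hm⟩) (.inl rfl) (h.trans (two_mul y))
  omega

theorem stanleySeq_eq_nth {A : Finset ℕ} {p : ℕ → Prop} {d : ℕ} (hinf : {n | p n}.Infinite)
    (hfree : ThreeAPFree {n | p n}) (hcover : CoversAbove p d) (hd : p d)
    (hA : ∀ n, n ∈ A ↔ p n ∧ n ≤ d) (n : ℕ) : stanleySeq A n = Nat.nth p n := by
  classical
  induction n using Nat.strong_induction_on with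
  | _ n ih =>
    rw [stanleySeq]
    split_ifs with h
    · exact orderEmbOfFin_eq_nth hinf hA ⟨n, h⟩
    · have hn : Nat.count p d < n := by
        rw [card_eq_count_succ hA, Nat.count_succ, if_pos hd] at h
        omega
      simp only [fun m : Fin n => ih m m.2]
      exact (isLeast_nth_of_coversAbove hinf hfree hcover hd hn).csInf_eq

theorem exists_character_of_three_pow_add {a : ℕ → ℕ} {k₀ : ℕ} (ha₀ : a 0 = 0)
    (ha : ∀ k ≥ k₀, ∀ i < 2 ^ k, a (2 ^ k + i) = 3 ^ k + a i) :
    ∃ c : ℤ, ∀ k ≥ k₀, (∀ i < 2 ^ k, a (2 ^ k + i) = a (2 ^ k) + a i) ∧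
      (a (2 ^ k) : ℤ) = 2 * (a (2 ^ k - 1) : ℤ) - c + 1 := by
  have hpow : ∀ k ≥ k₀, a (2 ^ k) = 3 ^ k := fun k hk => by
    simpa only [add_zero, ha₀] using ha k hk 0 (by positivity)
  refine ⟨2 * a (2 ^ k₀ - 1) - 3 ^ k₀ + 1, fun k hk => ?_⟩
  rw [hpow k hk]
  refine ⟨ha k hk, ?_⟩
  induction k, hk using Nat.le_induction with
  | base => push_cast; ring
  | succ k hk ih =>
    have hpos : 0 < 2 ^ k := by positivity
    rw [show 2 ^ (k + 1) - 1 = 2 ^ k + (2 ^ k - 1) by rw [pow_succ]; omega,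
      ha k hk _ (by omega)]
    push_cast at ih ⊢
    rw [pow_succ]
    linarith

/-- For `N` without a ternary digit `2` directly below a `1`, `StanleyTerm N n` says that `n` is a
term of the Stanley sequence whose initial set consists of the numbers obtained from `N` by
replacing some ternary digits with `0`. The constructors prescribe the lowest digit of `n`: at a
digit `d` of `N` it may be `0` or `d`, and at a digit `0` of `N` it may also be `1`, provided that
the higher digits form the sum of those of `N` and a number with digits `0` and `1`. In particular
`StanleyTerm 0` holds exactly for the numbers all of whose ternary digits are `0` or `1`. -/
inductive StanleyTerm : ℕ → ℕ → Prop
  | zero : StanleyTerm 0 0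
  | erase {N n d : ℕ} (h : StanleyTerm N n) (hd : d < 3) : StanleyTerm (3 * N + d) (3 * n)
  | keep {N n d : ℕ} (h : StanleyTerm N n) (hd : d < 3) : StanleyTerm (3 * N + d) (3 * n + d)
  | raise (N : ℕ) {b : ℕ} (hb : StanleyTerm 0 b) : StanleyTerm (3 * N) (3 * (N + b) + 1)

namespace StanleyTerm

theorem three_mul {N n : ℕ} (h : StanleyTerm N n) : StanleyTerm (3 * N) (3 * n) :=
  h.erase (d := 0) (by norm_num)

theorem three_mul_add_one {b : ℕ} (hb : StanleyTerm 0 b) : StanleyTerm 0 (3 * b + 1) := by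
  simpa only [mul_zero, zero_add] using hb.raise 0

theorem three_mul_iff {N n : ℕ} : StanleyTerm (3 * N) n ↔
    (∃ m, StanleyTerm N m ∧ n = 3 * m) ∨ ∃ b, StanleyTerm 0 b ∧ n = 3 * (N + b) + 1 := by
  constructor
  · generalize hM : 3 * N = M
    rintro (_ | @⟨N', _, d, h, hd⟩ | @⟨N', _, d, h, hd⟩ | ⟨N', hb⟩)
    · obtain rfl : N = 0 := by omega
      exact .inl ⟨0, zero, rfl⟩
    · obtain rfl : N = N' := by omega
      exact .inl ⟨_, h, rfl⟩
    · obtain ⟨rfl, rfl⟩ : N = N' ∧ d = 0 := by omega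
      exact .inl ⟨_, h, rfl⟩
    · obtain rfl : N = N' := by omega
      exact .inr ⟨_, hb, rfl⟩
  · rintro (⟨m, hm, rfl⟩ | ⟨b, hb, rfl⟩)
    exacts [hm.three_mul, hb.raise N]

theorem three_mul_add_iff {N n d : ℕ} (hd : d = 1 ∨ d = 2) : StanleyTerm (3 * N + d) n ↔
    ∃ m, StanleyTerm N m ∧ (n = 3 * m ∨ n = 3 * m + d) := by
  constructor
  · generalize hM : 3 * N + d = M
    rintro (_ | @⟨N', _, d', h, hd'⟩ | @⟨N', _, d', h, hd'⟩ | ⟨N', hb⟩)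
    · omega
    · obtain rfl : N = N' := by omega
      exact ⟨_, h, .inl rfl⟩
    · obtain ⟨rfl, rfl⟩ : N = N' ∧ d = d' := by omega
      exact ⟨_, h, .inr rfl⟩
    · omega
  · rintro ⟨m, hm, rfl | rfl⟩
    exacts [hm.erase (by omega), hm.keep (by omega)]

theorem three_mul_digit_iff {N n e : ℕ} (he : e < 3) : StanleyTerm (3 * N) (3 * n + e) ↔
    (e = 0 ∧ StanleyTerm N n) ∨ (e = 1 ∧ ∃ b, StanleyTerm 0 b ∧ n = N + b) := by
  rw [three_mul_iff]
  constructor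
  · rintro (⟨m, hm, h⟩ | ⟨b, hb, h⟩)
    · obtain ⟨rfl, rfl⟩ : n = m ∧ e = 0 := by omega
      exact .inl ⟨rfl, hm⟩
    · exact .inr ⟨by omega, b, hb, by omega⟩
  · rintro (⟨rfl, hn⟩ | ⟨rfl, b, hb, rfl⟩)
    exacts [.inl ⟨n, hn, rfl⟩, .inr ⟨b, hb, rfl⟩]

theorem three_mul_add_digit_iff {N n d e : ℕ} (hd : d = 1 ∨ d = 2) (he : e < 3) :
    StanleyTerm (3 * N + d) (3 * n + e) ↔ (e = 0 ∨ e = d) ∧ StanleyTerm N n := by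
  rw [three_mul_add_iff hd]
  constructor
  · rintro ⟨m, hm, h⟩
    obtain rfl : n = m := by omega
    exact ⟨by omega, hm⟩
  · rintro ⟨he', hn⟩
    exact ⟨n, hn, by omega⟩

theorem zero_left_iff {n : ℕ} :
    StanleyTerm 0 n ↔ ∃ m, StanleyTerm 0 m ∧ (n = 3 * m ∨ n = 3 * m + 1) := by
  simpa only [mul_zero, zero_add, ← exists_or, ← and_or_left] using three_mul_iff (N := 0) (n := n)

theorem zero_digit_iff {n e : ℕ} (he : e < 3) :
    StanleyTerm 0 (3 * n + e) ↔ (e = 0 ∨ e = 1) ∧ StanleyTerm 0 n := by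
  simpa only [mul_zero, zero_add, exists_eq_right', ← or_and_right] using
    three_mul_digit_iff (N := 0) (n := n) he

theorem zero_right (N : ℕ) : StanleyTerm N 0 := by
  induction N using ternary_induction with
  | zero => exact zero
  | three_mul N ih => exact ih.three_mul
  | three_mul_add N d hd ih => exact ih.erase (by omega)

theorem self (N : ℕ) : StanleyTerm N N := by
  induction N using ternary_induction with
  | zero => exact zero
  | three_mul N ih => exact ih.three_mul
  | three_mul_add N d hd ih => exact ih.keep (by omega)

theorem and_le_iff {N n d : ℕ} (hd : d < 3) :
    StanleyTerm (3 * N + d) n ∧ n ≤ 3 * N + d ↔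
      ∃ m, (StanleyTerm N m ∧ m ≤ N) ∧ (n = 3 * m ∨ n = 3 * m + d) := by
  constructor
  · rintro ⟨h, hle⟩
    rcases Nat.eq_zero_or_pos d with rfl | hpos
    · obtain ⟨m, hm, rfl⟩ | ⟨b, -, rfl⟩ := three_mul_iff.1 h
      · exact ⟨m, ⟨hm, by omega⟩, .inl rfl⟩
      · omega
    · obtain ⟨m, hm, hn⟩ := (three_mul_add_iff (by omega)).1 h
      exact ⟨m, ⟨hm, by omega⟩, hn⟩
  · rintro ⟨m, ⟨hm, hle⟩, rfl | rfl⟩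
    exacts [⟨hm.erase hd, by omega⟩, ⟨hm.keep hd, by omega⟩]

theorem threeAPFree_zero : ThreeAPFree {n | StanleyTerm 0 n} := by
  intro x hx y hy z hz h
  induction y using Nat.strong_induction_on generalizing x z with
  | _ y ih =>
    rcases Nat.eq_zero_or_pos y with rfl | hpos
    · omega
    obtain ⟨x', hx', hxe⟩ := zero_left_iff.1 hx
    obtain ⟨y', hy', hye⟩ := zero_left_iff.1 hy
    obtain ⟨z', hz', hze⟩ := zero_left_iff.1 hz
    have := ih y' (by omega) hx' hy' hz' (by omega)
    omega

theorem threeAPFree (N : ℕ) : ThreeAPFree {n | StanleyTerm N n} := by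
  induction N using ternary_induction with
  | zero => exact threeAPFree_zero
  | three_mul N ih =>
    intro x hx y hy z hz h
    obtain ⟨x', hx', rfl⟩ | ⟨x', hx', rfl⟩ := three_mul_iff.1 hx <;>
    obtain ⟨y', hy', rfl⟩ | ⟨y', hy', rfl⟩ := three_mul_iff.1 hy <;>
    obtain ⟨z', hz', rfl⟩ | ⟨z', hz', rfl⟩ := three_mul_iff.1 hz <;> try omega
    · rw [ih hx' hy' hz' (by omega)]
    · rw [threeAPFree_zero hx' hy' hz' (by omega)]
  | three_mul_add N d hd ih =>
    intro x hx y hy z hz h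
    obtain ⟨x', hx', hxe⟩ := (three_mul_add_iff hd).1 hx
    obtain ⟨y', hy', hye⟩ := (three_mul_add_iff hd).1 hy
    obtain ⟨z', hz', hze⟩ := (three_mul_add_iff hd).1 hz
    have := ih hx' hy' hz' (by omega)
    omega

theorem exists_add_eq_two_mul (q : ℕ) :
    ∃ s c, StanleyTerm 0 s ∧ StanleyTerm 0 c ∧ s ≤ c ∧ s + q = 2 * c := by
  induction q using Nat.strong_induction_on with
  | _ q ih =>
    rcases Nat.eq_zero_or_pos q with rfl | hq
    · exact ⟨0, 0, zero, zero, le_rfl, rfl⟩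
    obtain ⟨s, c, hs, hc, hsc, h⟩ := ih (q / 3) (by omega)
    obtain hr | hr | hr : q % 3 = 0 ∨ q % 3 = 1 ∨ q % 3 = 2 := by omega
    · exact ⟨_, _, hs.three_mul, hc.three_mul, by omega, by omega⟩
    · exact ⟨_, _, hs.three_mul_add_one, hc.three_mul_add_one, by omega, by omega⟩
    · exact ⟨_, _, hs.three_mul, hc.three_mul_add_one, by omega, by omega⟩

end StanleyTerm

/-- No ternary digit `2` of the number is directly below a digit `1`. This is the
hypothesis on the sets `T₁`, `T₂`, read off the number with digits `1` on `T₁` and `2` on `T₂`. -/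
inductive NoTwoBelowOne : ℕ → Prop
  | zero : NoTwoBelowOne 0
  | three_mul {N : ℕ} (h : NoTwoBelowOne N) : NoTwoBelowOne (3 * N)
  | three_mul_add_one {N : ℕ} (h : NoTwoBelowOne N) : NoTwoBelowOne (3 * N + 1)
  | three_mul_add_two {N : ℕ} (h : NoTwoBelowOne N) (hN : N % 3 ≠ 1) : NoTwoBelowOne (3 * N + 2)

/-- Up to a borrow `i ∈ {0, 1}`, the reflection `s` of `N + q` in some `N + c`, where `c ≤ q` has
ternary digits `0` and `1`, is a Stanley term. This is what remains of the equation `x + z = 2 * y`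
with unknowns `x` and `y` above the lowest digit that is raised in `y` but not in `x`. -/
def ReflectsToTerm (N i q : ℕ) : Prop :=
  ∃ s c, StanleyTerm N s ∧ StanleyTerm 0 c ∧ c ≤ q ∧ s + (N + q) = 2 * (N + c) + i

namespace ReflectsToTerm

theorem zero_zero (q : ℕ) : ReflectsToTerm 0 0 q := by
  obtain ⟨s, c, hs, hc, hsc, h⟩ := StanleyTerm.exists_add_eq_two_mul q
  exact ⟨s, c, hs, hc, by omega, by omega⟩

theorem zero_one : ∀ q, ReflectsToTerm 0 1 q
  | 0 => ⟨1, 0, StanleyTerm.zero.three_mul_add_one, .zero, le_rfl, rfl⟩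
  | q + 1 => by
    obtain ⟨s, c, hs, hc, hcq, h⟩ := zero_zero q
    exact ⟨s, c, hs, hc, by omega, by omega⟩

theorem three_mul_zero {N : ℕ} (h₀ : ∀ q, ReflectsToTerm N 0 q) (q : ℕ) :
    ReflectsToTerm (3 * N) 0 q := by
  obtain ⟨s, c, hs, hc, hcq, h⟩ := h₀ (q / 3)
  obtain ⟨b, a, hb, ha, hba, h'⟩ := StanleyTerm.exists_add_eq_two_mul (q / 3)
  obtain hr | hr | hr : q % 3 = 0 ∨ q % 3 = 1 ∨ q % 3 = 2 := by omega
  · exact ⟨_, _, hs.three_mul, hc.three_mul, by omega, by omega⟩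
  · exact ⟨_, _, hb.raise N, ha.three_mul_add_one, by omega, by omega⟩
  · exact ⟨_, _, hs.three_mul, hc.three_mul_add_one, by omega, by omega⟩

theorem three_mul_one {N : ℕ} (h₀ : ∀ q, ReflectsToTerm N 0 q) (q : ℕ) :
    ReflectsToTerm (3 * N) 1 q := by
  obtain ⟨s, c, hs, hc, hcq, h⟩ := h₀ (q / 3)
  obtain ⟨b, a, hb, ha, hba, h'⟩ := StanleyTerm.exists_add_eq_two_mul (q / 3)
  obtain hr | hr | hr : q % 3 = 0 ∨ q % 3 = 1 ∨ q % 3 = 2 := by omega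
  · exact ⟨_, _, hb.raise N, ha.three_mul, by omega, by omega⟩
  · exact ⟨_, _, hs.three_mul, hc.three_mul, by omega, by omega⟩
  · exact ⟨_, _, hb.raise N, ha.three_mul_add_one, by omega, by omega⟩

theorem three_mul_add_one_zero {N : ℕ} (h₀ : ∀ q, ReflectsToTerm N 0 q) (q : ℕ) :
    ReflectsToTerm (3 * N + 1) 0 q := by
  obtain ⟨s, c, hs, hc, hcq, h⟩ := h₀ (q / 3)
  obtain hr | hr | hr : q % 3 = 0 ∨ q % 3 = 1 ∨ q % 3 = 2 := by omega
  · exact ⟨_, _, hs.keep (by norm_num), hc.three_mul, by omega, by omega⟩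
  · exact ⟨_, _, hs.erase (by norm_num), hc.three_mul, by omega, by omega⟩
  · exact ⟨_, _, hs.keep (by norm_num), hc.three_mul_add_one, by omega, by omega⟩

theorem three_mul_add_two_zero {N : ℕ} (h₀ : ∀ q, ReflectsToTerm N 0 q)
    (h₁ : ∀ q, ReflectsToTerm N 1 q) (q : ℕ) : ReflectsToTerm (3 * N + 2) 0 q := by
  obtain ⟨s, c, hs, hc, hcq, h⟩ := h₀ (q / 3)
  obtain ⟨s', c', hs', hc', hcq', h'⟩ := h₁ (q / 3)
  obtain hr | hr | hr : q % 3 = 0 ∨ q % 3 = 1 ∨ q % 3 = 2 := by omega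
  · exact ⟨_, _, hs.keep (by norm_num), hc.three_mul, by omega, by omega⟩
  · exact ⟨_, _, hs'.erase (by norm_num), hc'.three_mul_add_one, by omega, by omega⟩
  · exact ⟨_, _, hs.erase (by norm_num), hc.three_mul, by omega, by omega⟩

theorem three_mul_add_two_one {N : ℕ} (h₀ : ∀ q, ReflectsToTerm N 0 q)
    (h₁ : ∀ q, ReflectsToTerm N 1 q) (q : ℕ) : ReflectsToTerm (3 * N + 2) 1 q := by
  obtain ⟨s, c, hs, hc, hcq, h⟩ := h₀ (q / 3)
  obtain ⟨s', c', hs', hc', hcq', h'⟩ := h₁ (q / 3)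
  obtain hr | hr | hr : q % 3 = 0 ∨ q % 3 = 1 ∨ q % 3 = 2 := by omega
  · exact ⟨_, _, hs'.erase (by norm_num), hc'.three_mul, by omega, by omega⟩
  · exact ⟨_, _, hs.keep (by norm_num), hc.three_mul, by omega, by omega⟩
  · exact ⟨_, _, hs'.erase (by norm_num), hc'.three_mul_add_one, by omega, by omega⟩

end ReflectsToTerm

namespace NoTwoBelowOne

theorem reflectsToTerm {N : ℕ} (hN : NoTwoBelowOne N) :
    (∀ q, ReflectsToTerm N 0 q) ∧ (N % 3 ≠ 1 → ∀ q, ReflectsToTerm N 1 q) := by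
  induction hN with
  | zero => exact ⟨ReflectsToTerm.zero_zero, fun _ => ReflectsToTerm.zero_one⟩
  | three_mul _ ih =>
    exact ⟨ReflectsToTerm.three_mul_zero ih.1, fun _ => ReflectsToTerm.three_mul_one ih.1⟩
  | three_mul_add_one _ ih =>
    exact ⟨ReflectsToTerm.three_mul_add_one_zero ih.1, fun h => by omega⟩
  | three_mul_add_two _ hN ih =>
    exact ⟨ReflectsToTerm.three_mul_add_two_zero ih.1 (ih.2 hN),
      fun _ => ReflectsToTerm.three_mul_add_two_one ih.1 (ih.2 hN)⟩

end NoTwoBelowOne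

namespace StanleyTerm

theorem coversAbove_zero : CoversAbove (StanleyTerm 0) 0 := fun z _ => exists_add_eq_two_mul z

theorem coversAbove_three_mul {N : ℕ} (hcover : CoversAbove (StanleyTerm N) N)
    (hreflect : ∀ q, ReflectsToTerm N 0 q) : CoversAbove (StanleyTerm (3 * N)) (3 * N) := by
  intro z hz
  obtain hr | hr | hr : z % 3 = 0 ∨ z % 3 = 1 ∨ z % 3 = 2 := by omega
  · obtain ⟨x, y, hx, hy, hxy, h⟩ := hcover (z / 3) (by omega)
    exact ⟨_, _, hx.three_mul, hy.three_mul, by omega, by omega⟩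
  · obtain ⟨x, y, hx, hy, hxy, h⟩ := exists_add_eq_two_mul (z / 3 - N)
    exact ⟨_, _, hx.raise N, hy.raise N, by omega, by omega⟩
  · obtain ⟨x, y, hx, hy, hyq, h⟩ := hreflect (z / 3 - N)
    exact ⟨_, _, hx.three_mul, hy.raise N, by omega, by omega⟩

theorem coversAbove_three_mul_add {N d : ℕ} (hd : d = 1 ∨ d = 2)
    (hcover : CoversAbove (StanleyTerm N) N) :
    CoversAbove (StanleyTerm (3 * N + d)) (3 * N + d) := by
  intro z hz
  obtain ⟨m, hm, hzm⟩ : ∃ m ≥ N, z = 3 * m ∨ z = 3 * m + d ∨ z = 3 * m + 2 * d := by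
    rcases (by omega : z % 3 = 0 ∨ z % 3 = d ∨ z % 3 = 2 * d % 3) with h | h | h
    · exact ⟨z / 3, by omega, by omega⟩
    · exact ⟨z / 3, by omega, by omega⟩
    · exact ⟨(z - 2 * d) / 3, by omega, by omega⟩
  obtain ⟨x, y, hx, hy, hxy, h⟩ := hcover m hm
  have hd3 : d < 3 := by omega
  rcases hzm with rfl | rfl | rfl
  · exact ⟨_, _, hx.erase hd3, hy.erase hd3, by omega, by omega⟩
  · exact ⟨_, _, hx.keep hd3, hy.keep hd3, by omega, by omega⟩
  · exact ⟨_, _, hx.erase hd3, hy.keep hd3, by omega, by omega⟩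

theorem coversAbove {N : ℕ} (hN : NoTwoBelowOne N) : CoversAbove (StanleyTerm N) N := by
  induction hN with
  | zero => exact coversAbove_zero
  | three_mul hN ih => exact coversAbove_three_mul ih hN.reflectsToTerm.1
  | three_mul_add_one _ ih => exact coversAbove_three_mul_add (.inl rfl) ih
  | three_mul_add_two _ _ ih => exact coversAbove_three_mul_add (.inr rfl) ih

theorem two_mul_lt_three_pow {b k : ℕ} (hb : StanleyTerm 0 b) (hbk : b < 3 ^ k) :
    2 * b < 3 ^ k := by
  induction k generalizing b with
  | zero => omega
  | succ k ih =>
    rw [pow_succ] at hbk ⊢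
    obtain ⟨m, hm, hbm⟩ := zero_left_iff.1 hb
    have := ih hm (by omega)
    omega

theorem add_lt_three_pow {N b k : ℕ} (hN : 2 * N < 3 ^ k) (hb : StanleyTerm 0 b)
    (hbk : b < 3 ^ k) : N + b < 3 ^ k := by
  have := hb.two_mul_lt_three_pow hbk
  omega

theorem zero_three_pow_add_iff {k m : ℕ} (hm : m < 3 ^ k) :
    StanleyTerm 0 (3 ^ k + m) ↔ StanleyTerm 0 m := by
  induction k generalizing m with
  | zero =>
    obtain rfl : m = 0 := by omega
    exact iff_of_true zero.three_mul_add_one zero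
  | succ k ih =>
    obtain ⟨n, e, he, rfl⟩ := exists_eq_three_mul_add_lt m
    rw [pow_succ'] at hm ⊢
    rw [← add_assoc, ← mul_add, zero_digit_iff he, zero_digit_iff he, ih (by omega)]

theorem exists_three_pow_add_eq_add_iff {N k m : ℕ} (hN : 2 * N < 3 ^ k) (hm : m < 3 ^ k) :
    (∃ b, StanleyTerm 0 b ∧ 3 ^ k + m = N + b) ↔ ∃ b, StanleyTerm 0 b ∧ m = N + b := by
  constructor
  · rintro ⟨b, hb, h⟩
    have hbk : 3 ^ k ≤ b := by
      by_contra! hlt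
      have := add_lt_three_pow hN hb hlt
      omega
    obtain ⟨b, rfl⟩ := Nat.exists_eq_add_of_le hbk
    exact ⟨b, (zero_three_pow_add_iff (by omega)).1 hb, by omega⟩
  · rintro ⟨b, hb, rfl⟩
    exact ⟨3 ^ k + b, (zero_three_pow_add_iff (by omega)).2 hb, by omega⟩

theorem three_pow_add_iff {N k m : ℕ} (hN : 2 * N < 3 ^ k) (hm : m < 3 ^ k) :
    StanleyTerm N (3 ^ k + m) ↔ StanleyTerm N m := by
  induction k generalizing N m with
  | zero =>
    obtain rfl : N = 0 := by omega
    exact zero_three_pow_add_iff hm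
  | succ k ih =>
    obtain ⟨n, e, he, rfl⟩ := exists_eq_three_mul_add_lt m
    rw [pow_succ'] at hN hm ⊢
    rw [← add_assoc, ← mul_add]
    obtain ⟨M, rfl | ⟨d, hd, rfl⟩⟩ := exists_eq_three_mul_or_eq_three_mul_add N
    · rw [three_mul_digit_iff he, three_mul_digit_iff he, ih (by omega) (by omega),
        exists_three_pow_add_eq_add_iff (by omega) (by omega)]
    · rw [three_mul_add_digit_iff hd he, three_mul_add_digit_iff hd he,
        ih (by omega) (by omega)]

theorem infinite (N : ℕ) : {n | StanleyTerm N n}.Infinite := by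
  refine Set.infinite_of_forall_exists_gt fun a => ?_
  obtain ⟨k, hk⟩ := pow_unbounded_of_one_lt (a + 2 * N) (by norm_num : 1 < 3)
  exact ⟨3 ^ k, (three_pow_add_iff (by omega) (by positivity)).2 (zero_right N), by omega⟩

open Classical in
theorem count_zero_three_pow (k : ℕ) : Nat.count (StanleyTerm 0) (3 ^ k) = 2 ^ k := by
  induction k with
  | zero => rw [pow_zero, Nat.count_one, if_pos zero, pow_zero]
  | succ k ih =>
    rw [pow_succ', count_three_mul_of_digit_iff (.inl rfl) fun n e he => zero_digit_iff he, ih,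
      pow_succ']

open Classical in
theorem count_exists_eq_add_three_pow {N k : ℕ} (hN : 2 * N < 3 ^ k) :
    Nat.count (fun m => ∃ b, StanleyTerm 0 b ∧ m = N + b) (3 ^ k) = 2 ^ k := by
  have hgap : ∀ b, 3 ^ k - N ≤ b → b < 3 ^ k → ¬ StanleyTerm 0 b := fun b hle hlt hb => by
    have := add_lt_three_pow hN hb hlt
    omega
  have h := count_exists_eq_add (StanleyTerm 0) N (3 ^ k - N)
  rw [← count_zero_three_pow, count_eq_of_forall_not (Nat.sub_le _ _) hgap, ← h]
  congr 1
  omega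

open Classical in
theorem count_three_pow {N k : ℕ} (hN : 2 * N < 3 ^ k) :
    Nat.count (StanleyTerm N) (3 ^ k) = 2 ^ k := by
  induction k generalizing N with
  | zero =>
    obtain rfl : N = 0 := by omega
    exact count_zero_three_pow 0
  | succ k ih =>
    rw [pow_succ'] at hN
    rw [pow_succ', pow_succ']
    obtain ⟨M, rfl | ⟨d, hd, rfl⟩⟩ := exists_eq_three_mul_or_eq_three_mul_add N
    · have hM : 2 * M < 3 ^ k := by omega
      rw [count_three_mul]
      simp only [three_mul_digit_iff, Nat.reduceLT, true_and, false_and, zero_ne_one, one_ne_zero,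
        OfNat.ofNat_ne_zero, OfNat.ofNat_ne_one, or_false, false_or, Nat.count_false,
        count_exists_eq_add_three_pow hM]
      rw [ih hM, add_zero, two_mul]
    · rw [count_three_mul_of_digit_iff hd fun n e he => three_mul_add_digit_iff hd he,
        ih (by omega)]

theorem nth_two_pow_add {N k i : ℕ} (hN : 2 * N < 3 ^ k) (hi : i < 2 ^ k) :
    Nat.nth (StanleyTerm N) (2 ^ k + i) = 3 ^ k + Nat.nth (StanleyTerm N) i := by
  classical
  rw [← count_three_pow hN] at hi ⊢
  exact nth_count_add (infinite N) (fun m hm => three_pow_add_iff hN hm) hi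

end StanleyTerm

theorem NoTwoBelowOne.isIndependentStanley {N : ℕ} {A : Finset ℕ} (hN : NoTwoBelowOne N)
    (hA : ∀ n, n ∈ A ↔ StanleyTerm N n ∧ n ≤ N) : IsIndependentStanley A := by
  have hseq : stanleySeq A = Nat.nth (StanleyTerm N) := funext <|
    stanleySeq_eq_nth (StanleyTerm.infinite N) (StanleyTerm.threeAPFree N)
      (StanleyTerm.coversAbove hN) (.self N) hA
  obtain ⟨k₀, hk₀⟩ := pow_unbounded_of_one_lt (2 * N) (by norm_num : 1 < 3)
  obtain ⟨c, hc⟩ := exists_character_of_three_pow_add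
    (Nat.nth_zero_of_zero (StanleyTerm.zero_right N))
    fun k (hk : k ≥ k₀) i hi =>
      StanleyTerm.nth_two_pow_add (hk₀.trans_le (Nat.pow_le_pow_right (by norm_num) hk)) hi
  exact ⟨⟨N, (hA N).2 ⟨.self N, le_rfl⟩⟩,
    (StanleyTerm.threeAPFree N).mono fun n hn => ((hA n).1 hn).1, c, k₀, by rwa [hseq]⟩

/-- The ternary digit `c i` of the number `∑ i, c i * 3 ^ i`, where `c i` is `1` for `i ∈ T₁`, `2`
for `i ∈ T₂` and `0` elsewhere. -/
def ternaryDigit (T₁ T₂ : Finset ℕ) (i : ℕ) : ℕ :=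
  if i ∈ T₁ then 1 else if i ∈ T₂ then 2 else 0

theorem ternaryDigit_lt_three (T₁ T₂ : Finset ℕ) (i : ℕ) : ternaryDigit T₁ T₂ i < 3 := by
  unfold ternaryDigit
  split_ifs <;> norm_num

theorem ternaryDigit_eq_one_iff {T₁ T₂ : Finset ℕ} {i : ℕ} :
    ternaryDigit T₁ T₂ i = 1 ↔ i ∈ T₁ := by
  unfold ternaryDigit
  split_ifs <;> simp_all

theorem ternaryDigit_eq_two_iff {T₁ T₂ : Finset ℕ} (hdisj : Disjoint T₁ T₂) {i : ℕ} :
    ternaryDigit T₁ T₂ i = 2 ↔ i ∈ T₂ := by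
  have hi : i ∈ T₁ → i ∉ T₂ := fun h => Finset.disjoint_left.1 hdisj h
  unfold ternaryDigit
  split_ifs <;> simp_all

theorem sum_ternaryDigit_mul {T₁ T₂ S : Finset ℕ} (hT₁ : T₁ ⊆ S) (hT₂ : T₂ ⊆ S)
    (hdisj : Disjoint T₁ T₂) : ∑ i ∈ S, ternaryDigit T₁ T₂ i * 3 ^ i =
      ∑ a ∈ T₁, 3 ^ a + 2 * ∑ b ∈ T₂, 3 ^ b := by
  have hsplit : ∀ i, ternaryDigit T₁ T₂ i * 3 ^ i =
      (if i ∈ T₁ then 3 ^ i else 0) + 2 * if i ∈ T₂ then 3 ^ i else 0 := fun i => by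
    have hi : i ∈ T₁ → i ∉ T₂ := fun h => Finset.disjoint_left.1 hdisj h
    unfold ternaryDigit
    split_ifs <;> simp_all
  simp only [hsplit, Finset.sum_add_distrib, ← Finset.mul_sum, Finset.sum_ite_mem,
    Finset.inter_eq_right.2 hT₁, Finset.inter_eq_right.2 hT₂]

theorem mem_ternaryDigitSet_iff {T₁ T₂ S : Finset ℕ} (hT₁ : T₁ ⊆ S) (hT₂ : T₂ ⊆ S)
    (hdisj : Disjoint T₁ T₂) {n : ℕ} : n ∈ ternaryDigitSet T₁ T₂ ↔
      ∃ e : ℕ → ℕ, (∀ i, e i = 0 ∨ e i = ternaryDigit T₁ T₂ i) ∧ n = ∑ i ∈ S, e i * 3 ^ i := by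
  simp only [ternaryDigitSet, Finset.mem_image, Finset.mem_product, Finset.mem_powerset,
    Prod.exists]
  constructor
  · rintro ⟨U, V, ⟨hU, hV⟩, rfl⟩
    refine ⟨ternaryDigit U V, fun i => ?_, (sum_ternaryDigit_mul (hU.trans hT₁) (hV.trans hT₂)
      (hdisj.mono hU hV)).symm⟩
    have hi : i ∈ T₁ → i ∉ T₂ := fun h => Finset.disjoint_left.1 hdisj h
    have := @hU i
    have := @hV i
    unfold ternaryDigit
    split_ifs <;> simp_all
  · rintro ⟨e, he, rfl⟩
    have hU : T₁.filter (e · ≠ 0) ⊆ T₁ := Finset.filter_subset _ _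
    have hV : T₂.filter (e · ≠ 0) ⊆ T₂ := Finset.filter_subset _ _
    refine ⟨_, _, ⟨hU, hV⟩, ?_⟩
    rw [← sum_ternaryDigit_mul (hU.trans hT₁) (hV.trans hT₂) (hdisj.mono hU hV)]
    refine Finset.sum_congr rfl fun i _ => ?_
    have := he i
    have hi : i ∈ T₁ → i ∉ T₂ := fun h => Finset.disjoint_left.1 hdisj h
    congr 1
    unfold ternaryDigit at *
    split_ifs at * <;> simp_all

theorem stanleyTerm_sum_and_le_iff {c : ℕ → ℕ} (hc : ∀ i, c i < 3) (m n : ℕ) :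
    (StanleyTerm (∑ i ∈ Finset.range m, c i * 3 ^ i) n ∧
      n ≤ ∑ i ∈ Finset.range m, c i * 3 ^ i) ↔
    ∃ e : ℕ → ℕ, (∀ i, e i = 0 ∨ e i = c i) ∧ n = ∑ i ∈ Finset.range m, e i * 3 ^ i := by
  induction m generalizing c n with
  | zero =>
    simp only [Finset.range_zero, Finset.sum_empty, Nat.le_zero]
    exact ⟨fun h => ⟨c, fun _ => .inr rfl, h.2⟩, fun ⟨_, _, h⟩ => ⟨h ▸ .zero, h⟩⟩
  | succ m ih =>
    simp only [sum_range_succ_mul_three_pow, StanleyTerm.and_le_iff (hc 0),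
      ih fun i => hc (i + 1)]
    constructor
    · rintro ⟨l, ⟨e, he, rfl⟩, hn⟩
      obtain ⟨e₀, he₀, rfl⟩ : ∃ e₀, (e₀ = 0 ∨ e₀ = c 0) ∧
          n = 3 * ∑ i ∈ Finset.range m, e i * 3 ^ i + e₀ := by
        rcases hn with rfl | rfl
        exacts [⟨0, .inl rfl, rfl⟩, ⟨c 0, .inr rfl, rfl⟩]
      exact ⟨fun i => i.casesOn e₀ e, fun i => i.casesOn he₀ he, rfl⟩
    · rintro ⟨e, he, rfl⟩
      refine ⟨_, ⟨fun i => e (i + 1), fun i => he (i + 1), rfl⟩, ?_⟩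
      exact (he 0).imp (fun h => by rw [h, add_zero]) fun h => by rw [h]

theorem noTwoBelowOne_sum {c : ℕ → ℕ} (hc : ∀ i, c i < 3) (hc' : ∀ i, c i = 2 → c (i + 1) ≠ 1)
    (m : ℕ) : NoTwoBelowOne (∑ i ∈ Finset.range m, c i * 3 ^ i) := by
  induction m generalizing c with
  | zero => exact .zero
  | succ m ih =>
    have hhigh := ih (fun i => hc (i + 1)) fun i => hc' (i + 1)
    rw [sum_range_succ_mul_three_pow]
    obtain h | h | h : c 0 = 0 ∨ c 0 = 1 ∨ c 0 = 2 := by have := hc 0; omega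
    · rw [h]
      exact hhigh.three_mul
    · rw [h]
      exact hhigh.three_mul_add_one
    · rw [h]
      refine hhigh.three_mul_add_two ?_
      cases m with
      | zero => simp only [Finset.range_zero, Finset.sum_empty, Nat.zero_mod, ne_eq,
          zero_ne_one, not_false_eq_true]
      | succ m =>
        rw [sum_range_succ_mul_three_pow, Nat.mul_add_mod, Nat.mod_eq_of_lt (hc _)]
        exact hc' 0 h

theorem theorem3 (k : ℕ) (hk : 0 < k) (T₁ T₂ : Finset ℕ)
    (hT₁ : T₁ ⊆ Finset.range (k + 1)) (hT₂ : T₂ ⊆ Finset.range (k + 1))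
    (hdisj : Disjoint T₁ T₂)
    (hpred : ∀ t ∈ T₁, ∀ s ∈ T₂, (s : ℤ) ≠ (t : ℤ) - 1) :
    IsIndependentStanley (ternaryDigitSet T₁ T₂) := by
  have hdigit : ∀ i, ternaryDigit T₁ T₂ i = 2 → ternaryDigit T₁ T₂ (i + 1) ≠ 1 := by
    simp only [ne_eq, ternaryDigit_eq_two_iff hdisj, ternaryDigit_eq_one_iff]
    exact fun i h₂ h₁ => hpred _ h₁ _ h₂ (by push_cast; ring)
  have hN := noTwoBelowOne_sum (ternaryDigit_lt_three T₁ T₂) hdigit (k + 1)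
  refine hN.isIndependentStanley fun n => ?_
  rw [mem_ternaryDigitSet_iff hT₁ hT₂ hdisj,
    stanleyTerm_sum_and_le_iff (ternaryDigit_lt_three T₁ T₂)]
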